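/- An $i$-hedrite is a $2$-connected $4$-valent plane graph (multiple edges allowed) all of whose faces, the outer one included, are $2$-gons, $3$-gons or $4$-gons, and which has exactly $8-i$ faces that are $2$-gons. A central circuit is a closed walk obtained by starting with an edge and continuing at each vertex along the edge opposite to the entering one; the central circuits partition the edge set. A rail-road is a circuit of $4$-gonal faces, possibly self-intersecting, in which every $4$-gon is adjacent to its two neighbours in the circuit on opposite edges. An $i$-hedrite is irreducible if it contains no rail-road. **Theorem.** Every irreducible $i$-hedrite has at most $i-2$ central circuits, and for each $i\in\{4,5,6,7,8\}$ there is an irreducible $i$-hedrite with exactly $i-2$ central circuits. -/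

import Mathlib

/-- A (finite, nonempty, connected) graph embedded in the plane, equivalently in the sphere,
multiple edges allowed, up to orientation-preserving homeomorphism: a combinatorial map of genus
zero.  `D` is the set of darts (edges with a direction, each dart being attached to its initial
vertex), `rot` sends a dart to the next dart in counterclockwise order around its initial vertex,
and `rev` reverses a dart.  Vertices, edges and faces (the outer face included) are the cycles of
`rot`, `rev` and `rot ∘ rev`; planarity is Euler's formula. -/
structure PlaneGraph (D : Type*) [Finite D] where
  rot : Equiv.Perm D
  rev : Equiv.Perm D
  rev_rev : ∀ d, rev (rev d) = d
  rev_ne : ∀ d, rev d ≠ d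
  connected : ∀ d e, ∃ g ∈ Subgroup.closure {rot, rev}, g d = e
  euler : (Set.range fun d => {e | rot.SameCycle d e}).ncard
      + (Set.range fun d => {e | (rot * rev).SameCycle d e}).ncard
      = (Set.range fun d => {e | rev.SameCycle d e}).ncard + 2

namespace PlaneGraph

variable {D : Type*} [Finite D] (G : PlaneGraph D)

/-- The boundary walk of the face next to a dart: traverse the dart, then turn to the
neighbouring dart at its end. -/
def face : Equiv.Perm D := G.rot * G.rev

/-- The darts issuing from the initial vertex of `d`. -/
def vertexOf (d : D) : Set D := {e | G.rot.SameCycle d e}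

/-- The darts bounding the face of `d`; their number is the length of the boundary walk. -/
def faceOf (d : D) : Set D := {e | G.face.SameCycle d e}

/-- The set of faces. -/
def faces : Set (Set D) := Set.range G.faceOf

/-- `p_k`, the number of `k`-gonal faces. -/
noncomputable def p (k : ℕ) : ℕ := {F ∈ G.faces | F.ncard = k}.ncard

/-- Every vertex has degree four. -/
def FourValent : Prop := ∀ d, (G.vertexOf d).ncard = 4

/-- No vertex disconnects the (connected) graph: after deleting the vertex of `c`, any two darts
at remaining vertices can be joined by turning around remaining vertices and moving along edges
between remaining vertices. -/
def TwoConnected : Prop :=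
  ∀ c d e : D, d ∉ G.vertexOf c → e ∉ G.vertexOf c →
    Relation.ReflTransGen
      (fun x y => y ∉ G.vertexOf c ∧ (y ∈ G.vertexOf x ∨ y = G.rev x)) d e

/-- An `i`-hedrite: a `2`-connected `4`-valent plane graph all of whose faces are `2`-, `3`- or
`4`-gons, with `p₂ = 8 - i`. -/
structure IsHedrite (i : ℕ) : Prop where
  fourValent : G.FourValent
  twoConnected : G.TwoConnected
  face_size : ∀ F ∈ G.faces, F.ncard = 2 ∨ F.ncard = 3 ∨ F.ncard = 4
  p_two : G.p 2 + i = 8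

/-- Going straight ahead in a `4`-valent plane graph: traverse the dart, then leave its end vertex
along the opposite edge. -/
def straight : Equiv.Perm D := G.rot ^ 2 * G.rev

/-- The central circuit through the edge of `d`, as the set of its edges, each edge being
represented by its two darts: the darts met when going straight ahead from `d`, together with
their reverses. -/
def centralCircuit (d : D) : Set D :=
  {e | G.straight.SameCycle d e ∨ G.straight.SameCycle d (G.rev e)}

/-- The number of central circuits. -/
noncomputable def numCentralCircuits : ℕ := (Set.range G.centralCircuit).ncard

/-- `G` contains a rail-road: a cyclic sequence of `4`-gons, possibly self-intersecting, in which
each `4`-gon is adjacent to its predecessor and its successor on opposite edges.  Here `r j` is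
the dart on the boundary of the `j`-th `4`-gon whose edge is shared with the next one; so
`rev (r j)` lies on the boundary of the next `4`-gon, and `r (j + 1)` is opposite to it there. -/
def HasRailRoad : Prop :=
  ∃ (k : ℕ) (r : ℕ → D), 0 < k ∧ (∀ j, r (j + k) = r j) ∧
    ∀ j, (G.faceOf (r j)).ncard = 4 ∧ r (j + 1) = (G.face ^ 2) (G.rev (r j))

/-- `G` contains no rail-road. -/
def Irreducible : Prop := ¬ G.HasRailRoad

end PlaneGraph

namespace PlaneGraph

/-! Let c be the number of central circuits and V, E the numbers of vertices and edges. A vector at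
every vertex, recorded by its components along the four darts, is a dart function odd under `rot ^
2`. Its analogue on the faces is odd under `face ^ 2`; this leaves two degrees of freedom on a 4-gon
and none on a 2-gon or 3-gon.

A vertex field with weights on the central circuits produces a tangential and a normal number on
each edge, and so does a face field with circuit weights. Summation by parts (`sum_vertex_mul_face`)
makes the two images orthogonal in the 2E-dimensional space of edge data. Both maps are injective
(`vertex_eq_zero`, `face_eq_zero`): a kernel element yields a face field that is constant along each
side of each circuit. Such a side borders a face that is no 4-gon, since otherwise the 4-gons along
it would form a rail-road, and at that face the field vanishes.

Hence 2c + 2V + 2p₄ ≤ 2E = 4V. Euler's formula gives V + 2 faces and 2p₂ + p₃ = 8, so c ≤ V − p₄ =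
p₂ + p₃ − 2 = i − 2.

Sharpness is witnessed by five explicit graphs. Their circuits are only bounded from below, by a
labelling; the general inequality supplies the other bound. -/

/-! ### Cycles of a permutation, and functions odd under an involution -/

theorem ncard_sameCycle {D : Type*} [Finite D] (π : Equiv.Perm D) (d : D) :
    {e | π.SameCycle d e}.ncard = Function.minimalPeriod π d := by
  have : Fintype (MulAction.orbit (Subgroup.zpowers π) d) := Fintype.ofFinite _
  refine Eq.trans ?_ (MulAction.minimalPeriod_eq_card (a := π) (b := d)).symm
  rw [← Nat.card_eq_fintype_card, Nat.card_coe_set_eq]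
  congr 1
  ext e
  simp only [Set.mem_ofPred_eq, MulAction.mem_orbit_iff, Subtype.exists, Subgroup.mem_zpowers_iff]
  constructor
  · rintro ⟨i, hi⟩
    exact ⟨π ^ i, ⟨i, rfl⟩, hi⟩
  · rintro ⟨_, ⟨i, rfl⟩, hi⟩
    exact ⟨i, hi⟩

theorem card_eq_sum_ncard_sameCycle {D : Type*} [Fintype D] (π : Equiv.Perm D) (P : ℕ → Prop) [DecidablePred P] :
    ({d : D | P ({e | π.SameCycle d e}.ncard)} : Finset D).card = 
     ∑ F ∈ (Set.finite_range fun d => {e | π.SameCycle d e}).toFinset, if P F.ncard then F.ncard else 0 := by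
  classical
  rw [← Finset.sum_filter, Finset.card_eq_sum_card_fiberwise (f := fun d => {e | π.SameCycle d e}) (t := {F ∈ (Set.finite_range fun d => {e | π.SameCycle d e}).toFinset | P F.ncard})]
  · refine Finset.sum_congr rfl fun F hF => ?_
    simp only [Finset.mem_filter, Set.Finite.mem_toFinset, Set.mem_range] at hF
    obtain ⟨⟨d, rfl⟩, hP⟩ := hF
    rw [← Set.ncard_coe_finset]
    congr 1
    ext e
    have key : ({x | π.SameCycle e x} = {x | π.SameCycle d x}) ↔ π.SameCycle d e := by
      constructor
      · intro h
        have : e ∈ {x | π.SameCycle e x} := Equiv.Perm.SameCycle.refl _ _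
        rwa [h] at this
      · intro h
        ext x
        exact ⟨fun k => h.trans k, fun k => h.symm.trans k⟩
    simp only [Finset.coe_filter, Finset.mem_filter, Finset.mem_univ, true_and, Set.mem_ofPred_eq, key]
    constructor
    · exact fun h => h.2
    · exact fun h => ⟨by rw [key.2 h]; exact hP, h⟩
  · intro d hd
    simpa using hd

/-- A set containing exactly one point of each two-element orbit of an involution. -/
theorem exists_transversal {D : Type*} [Finite D] (σ : D → D) (hσ : ∀ d, σ (σ d) = d) :
    ∃ S : Set D, ∀ d, σ d ≠ d → (σ d ∈ S ↔ d ∉ S) := by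
  obtain ⟨n, ⟨e⟩⟩ := Finite.exists_equiv_fin D
  refine ⟨{d | e d < e (σ d)}, fun d hd => ?_⟩
  have : e (σ d) ≠ e d := fun h => hd (e.injective h)
  simp only [Set.mem_ofPred_eq, hσ]
  constructor
  · intro h; exact not_lt.2 h.le
  · intro h; exact lt_of_le_of_ne (not_lt.1 h) this

theorem exists_sign {D : Type*} [Finite D] (σ : D → D) (hσ : ∀ d, σ (σ d) = d)
    (hne : ∀ d, σ d ≠ d) : ∃ ε : D → ℝ, (∀ d, ε (σ d) = - ε d) ∧ ∀ d, ε d * ε d = 1 := by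
  classical
  obtain ⟨S, hS⟩ := exists_transversal σ hσ
  refine ⟨fun d => if d ∈ S then 1 else -1, fun d => ?_, fun d => ?_⟩
  · have := hS d (hne d)
    by_cases h : d ∈ S <;> simp [h, this]
  · by_cases h : d ∈ S <;> simp [h]

/-- The functions changing sign under `σ`. -/
def antiInvariants {D : Type*} (σ : D → D) : Submodule ℝ (D → ℝ) where
  carrier := {u | ∀ d, u (σ d) = - u d}
  add_mem' {a b} ha hb d := by simp only [Pi.add_apply, ha d, hb d]; ring
  zero_mem' d := by simp
  smul_mem' c a ha d := by simp [ha d]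

/-- Values can be prescribed freely on one point of each pair in `Q`; antisymmetry fixes the other
point, and zero extends the function outside `Q`. It serves for `rot ^ 2` on all darts and for `face
^ 2` on the darts of 4-gons. -/
theorem card_le_two_mul_finrank_antiInvariants {D : Type*} [Fintype D] (σ : D → D) (Q : Finset D)
    (hQ : ∀ d ∈ Q, σ d ∈ Q ∧ σ (σ d) = d ∧ σ d ≠ d) (hQ' : ∀ d, σ d ∈ Q → d ∈ Q) :
    Q.card ≤ 2 * Module.finrank ℝ (antiInvariants σ) := by
  classical
  let τ : D → D := fun d => if d ∈ Q then σ d else d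
  have hτ : ∀ d, τ (τ d) = d := fun d => by
    by_cases h : d ∈ Q
    · simp [τ, h, (hQ d h).1, (hQ d h).2.1]
    · simp [τ, h]
  obtain ⟨S, hS⟩ := exists_transversal τ hτ
  have hSQ : ∀ d ∈ Q, (σ d ∈ S ↔ d ∉ S) := fun d hd => by
    have := hS d (by simp [τ, hd, (hQ d hd).2.2])
    simpa [τ, hd] using this
  let T : Finset D := {d ∈ Q | d ∈ S}
  have hT : Q.card ≤ 2 * T.card := by
    have h1 : Q.card = T.card + ({d ∈ Q | d ∉ S} : Finset D).card :=
      (Finset.card_filter_add_card_filter_not _).symm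
    have h2 : ({d ∈ Q | d ∉ S} : Finset D).card ≤ T.card := by
      refine Finset.card_le_card_of_injOn σ ?_ ?_
      · intro d hd
        simp only [Finset.coe_filter, Set.mem_ofPred_eq] at hd
        simp [T, (hQ d hd.1).1, hSQ d hd.1, hd.2]
      · intro d hd e he h
        simp only [Finset.coe_filter, Set.mem_ofPred_eq] at hd he
        rw [← (hQ d hd.1).2.1, h, (hQ e he.1).2.1]
    omega
  let f : (T → ℝ) →ₗ[ℝ] (D → ℝ) :=
    { toFun := fun g d => if h : d ∈ T then g ⟨d, h⟩ else if h : σ d ∈ T then - g ⟨σ d, h⟩ else 0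
      map_add' := fun g g' => by
        ext d; by_cases h : d ∈ T
        · simp [h]
        · by_cases h' : σ d ∈ T
          · simp [h, h']; ring
          · simp [h, h']
      map_smul' := fun c g => by
        ext d; by_cases h : d ∈ T
        · simp [h]
        · by_cases h' : σ d ∈ T <;> simp [h, h'] }
  have hf : ∀ g, f g ∈ antiInvariants σ := fun g d => by
    change (if h : σ d ∈ T then g ⟨σ d, h⟩ else if h : σ (σ d) ∈ T then - g ⟨σ (σ d), h⟩ else 0) =
      - (if h : d ∈ T then g ⟨d, h⟩ else if h : σ d ∈ T then - g ⟨σ d, h⟩ else 0)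
    by_cases hd : d ∈ Q
    · obtain ⟨h1, h2, h3⟩ := hQ d hd
      have h4 := hSQ d hd
      have hd1 : d ∈ T ↔ d ∈ S := by simp [T, hd]
      have hd2 : σ d ∈ T ↔ d ∉ S := by simp [T, h1, h4]
      simp only [h2]
      by_cases h : d ∈ S
      · have h5 : d ∈ T := hd1.2 h
        have h6 : σ d ∉ T := fun k => hd2.1 k h
        simp [h5, h6]
      · have h5 : d ∉ T := fun k => h (hd1.1 k)
        have h6 : σ d ∈ T := hd2.2 h
        simp [h5, h6]
    · have h1 : d ∉ T := fun k => hd (Finset.mem_filter.1 k).1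
      have h2 : σ d ∉ T := fun k => hd (hQ' _ (Finset.mem_filter.1 k).1)
      have h3 : σ (σ d) ∉ T := fun k => hd (hQ' _ (hQ' _ (Finset.mem_filter.1 k).1))
      simp [h1, h2, h3]
  have hinj : Function.Injective (f.codRestrict (antiInvariants σ) hf) := by
    intro g g' h
    ext ⟨d, hd⟩
    have := congrFun (congrArg Subtype.val h) d
    simpa [f, hd] using this
  have := LinearMap.finrank_le_finrank_of_injective hinj
  simp only [Module.finrank_fintype_fun_eq_card, Fintype.card_coe] at this
  omega

/-! ### The upper bound: twisted fields on vertices and faces -/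

section

variable {D : Type*} [Finite D] (G : PlaneGraph D)

theorem rot_rev (d : D) : G.rot (G.rev d) = G.face d := rfl

theorem face_rev (d : D) : G.face (G.rev d) = G.rot d := by
  simp [face, G.rev_rev]

theorem straight_apply (d : D) : G.straight d = G.rot (G.rot (G.rev d)) := rfl

theorem straight_eq (d : D) : G.straight d = G.face (G.rev (G.face d)) := by
  simp [face, straight_apply, G.rev_rev]

theorem face_pow_eq_iff (d : D) (n : ℕ) : (G.face ^ n) d = d ↔ (G.faceOf d).ncard ∣ n := by
  rw [faceOf, ncard_sameCycle, ← Function.isPeriodicPt_iff_minimalPeriod_dvd,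
    Function.IsPeriodicPt, Function.IsFixedPt, Equiv.Perm.iterate_eq_pow]

theorem rot_pow_eq_iff (d : D) (n : ℕ) : (G.rot ^ n) d = d ↔ (G.vertexOf d).ncard ∣ n := by
  rw [vertexOf, ncard_sameCycle, ← Function.isPeriodicPt_iff_minimalPeriod_dvd,
    Function.IsPeriodicPt, Function.IsFixedPt, Equiv.Perm.iterate_eq_pow]

theorem faceOf_eq {d e : D} (h : G.face.SameCycle d e) : G.faceOf e = G.faceOf d := by
  ext x
  exact ⟨fun k => h.trans k, fun k => h.symm.trans k⟩

theorem faceOf_face (d : D) : G.faceOf (G.face d) = G.faceOf d :=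
  G.faceOf_eq ⟨1, by simp⟩

/-- Every central circuit of an irreducible graph has a face that is no `4`-gon on each side. -/
theorem Irreducible.exists_ncard_ne_four {G : PlaneGraph D} (hG : G.Irreducible) (d : D) :
    ∃ n : ℕ, (G.faceOf ((G.straight ^ n) d)).ncard ≠ 4 := by
  by_contra! h
  obtain ⟨k, hk, hk'⟩ : ∃ k, 0 < k ∧ G.straight ^ k = 1 :=
    ⟨orderOf G.straight, orderOf_pos _, pow_orderOf_eq_one _⟩
  -- The 4-gons lie along one side of the circuit of `d`; consecutive ones share the edge that
  -- branches off to that side at the vertex between them.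
  refine hG ⟨k, fun j => G.face ((G.straight ^ j) d), hk, fun j => ?_, fun j => ⟨?_, ?_⟩⟩
  · simp only [pow_add, hk', mul_one]
  · rw [faceOf_face, h]
  · simp only [pow_succ' G.straight, Equiv.Perm.mul_apply, straight_eq]
    rfl

/-- Twisted functions on the faces of an irreducible graph that are constant along the sides of
central circuits vanish. -/
theorem Irreducible.eq_zero {G : PlaneGraph D} (hG : G.Irreducible)
    (hF : ∀ d, (G.faceOf d).ncard = 2 ∨ (G.faceOf d).ncard = 3 ∨ (G.faceOf d).ncard = 4)
    {u : D → ℝ} (h1 : ∀ d, u (G.face (G.face d)) = - u d) (h2 : ∀ d, u (G.straight d) = u d)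
    (d : D) : u d = 0 := by
  obtain ⟨n, hn⟩ := hG.exists_ncard_ne_four d
  have h3 : ∀ n : ℕ, u ((G.straight ^ n) d) = u d := fun n => by
    induction n with
    | zero => rfl
    | succ n ih => rw [pow_succ', Equiv.Perm.mul_apply, h2, ih]
  rw [← h3 n]
  generalize (G.straight ^ n) d = x at hn
  rcases hF x with h | h | h
  · have := (G.face_pow_eq_iff x 2).2 (by rw [h])
    have h4 := h1 x
    simp only [pow_succ, pow_zero, one_mul, Equiv.Perm.mul_apply] at this
    rw [this] at h4
    linarith
  -- Going twice around a 3-gon applies `face ^ 2` three times, an odd number of sign changes.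
  · have := (G.face_pow_eq_iff x 6).2 (by rw [h]; norm_num)
    have h4 := h1 x
    simp only [pow_succ, pow_zero, one_mul, Equiv.Perm.mul_apply] at this
    have h5 := h1 (G.face (G.face (G.face (G.face x))))
    rw [this, h1, h1] at h5
    linarith
  · exact absurd h hn

theorem FourValent.rot_four {G : PlaneGraph D} (h : G.FourValent) (d : D) :
    G.rot (G.rot (G.rot (G.rot d))) = d := by
  have := (G.rot_pow_eq_iff d 4).2 (by rw [h])
  simpa only [pow_succ, pow_zero, one_mul, Equiv.Perm.mul_apply] using this

theorem FourValent.rot_two_ne {G : PlaneGraph D} (h : G.FourValent) (d : D) :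
    G.rot (G.rot d) ≠ d := fun k => by
  have := (G.rot_pow_eq_iff d 2).1 (by
    simpa only [pow_succ, pow_zero, one_mul, Equiv.Perm.mul_apply] using k)
  rw [h] at this
  norm_num at this

/-- Conjugation by `rev` turns `straight` into its inverse, because `rot ^ 2` is an involution at
vertices of degree four. -/
theorem centralCircuit_rev (hG : G.FourValent) (d : D) :
    G.centralCircuit (G.rev d) = G.centralCircuit d := by
  have hc : G.rev * G.straight⁻¹ * G.rev⁻¹ = G.straight := by
    rw [mul_inv_eq_iff_eq_mul, mul_inv_eq_iff_eq_mul]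
    ext d
    simp [straight_apply, G.rev_rev, hG.rot_four]
  have key : ∀ x y, G.straight.SameCycle (G.rev x) (G.rev y) ↔ G.straight.SameCycle x y :=
    fun x y => by
    conv_lhs => rw [← hc]
    rw [Equiv.Perm.sameCycle_conj]
    simp
  ext e
  simp only [centralCircuit, Set.mem_ofPred_eq]
  rw [key, or_comm, ← key _ (G.rev e), G.rev_rev]

theorem centralCircuit_straight (d : D) :
    G.centralCircuit (G.straight d) = G.centralCircuit d := by
  ext e
  simp only [centralCircuit, Set.mem_ofPred_eq, Equiv.Perm.sameCycle_apply_left]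

theorem centralCircuit_rot_rot (hG : G.FourValent) (d : D) :
    G.centralCircuit (G.rot (G.rot d)) = G.centralCircuit d := by
  rw [← G.centralCircuit_rev hG d, ← G.centralCircuit_straight (G.rev d), straight_apply,
    G.rev_rev]

/-- The tangential part of the cochain given by weights `a` on the central circuits and a twisted
function `v` on the vertices. -/
def vertexTangent (a v : D → ℝ) (d : D) : ℝ :=
  v d + v (G.rev d) + a (G.rot d) + a (G.face d)

/-- The normal part of the coboundary of a twisted function `v` on the vertices. -/
def vertexNormal (v : D → ℝ) (d : D) : ℝ := v (G.rot d) + v (G.face d)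

/-- The tangential part of the coboundary of a twisted function `u` on the faces. -/
def faceTangent (u : D → ℝ) (d : D) : ℝ := u (G.face d) + u (G.rot d)

/-- The normal part of the cochain given by weights `b` on the central circuits and a twisted
function `u` on the faces. -/
def faceNormal (b u : D → ℝ) (d : D) : ℝ := u d + u (G.rev d) + b d

theorem vertexTangent_rev (a v : D → ℝ) (d : D) :
    G.vertexTangent a v (G.rev d) = G.vertexTangent a v d := by
  simp only [vertexTangent, G.rev_rev, rot_rev, face_rev]; ring

theorem vertexNormal_rev (v : D → ℝ) (d : D) :
    G.vertexNormal v (G.rev d) = G.vertexNormal v d := by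
  simp only [vertexNormal, rot_rev, face_rev]; ring

theorem faceTangent_rev (u : D → ℝ) (d : D) :
    G.faceTangent u (G.rev d) = G.faceTangent u d := by
  simp only [faceTangent, rot_rev, face_rev]; ring

theorem faceNormal_rev (b u : D → ℝ) (hb : ∀ d, b (G.rev d) = b d) (d : D) :
    G.faceNormal b u (G.rev d) = G.faceNormal b u d := by
  simp only [faceNormal, G.rev_rev, hb]; ring

/-- Discrete summation by parts. Shifting by `face` or `rot` and using oddness, each `v`-`u` term of
the tangential product becomes minus a term of the normal product. The `v`-`b` terms cancel between
opposite darts at a vertex, where `v` is odd and `b` even. The `a`-`u` terms cancel in pairs, again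
by shifting along faces and around vertices. -/
theorem sum_vertex_mul_face [Fintype D] {a b u v : D → ℝ}
    (ha : ∀ d, a (G.rev d) = a d) (ha' : ∀ d, a (G.rot (G.rot d)) = a d)
    (hb : ∀ d, b (G.rev d) = b d) (hb' : ∀ d, b (G.rot (G.rot d)) = b d)
    (hu : ∀ d, u (G.face (G.face d)) = - u d) (hv : ∀ d, v (G.rot (G.rot d)) = - v d) :
    ∑ d, (G.vertexTangent a v d * G.faceTangent u d
      + G.vertexNormal v d * G.faceNormal b u d) = 0 := by
  have r : ∀ f : D → ℝ, ∑ d, f (G.rot d) = ∑ d, f d := fun f => Equiv.sum_comp G.rot f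
  have s : ∀ f : D → ℝ, ∑ d, f (G.rev d) = ∑ d, f d := fun f => Equiv.sum_comp G.rev f
  have t : ∀ f : D → ℝ, ∑ d, f (G.face d) = ∑ d, f d := fun f => Equiv.sum_comp G.face f
  have a1 := s fun d => v d * u (G.rot d)
  have a2 := s fun d => v d * u (G.face d)
  have a3 := s fun d => v (G.rot d) * u d
  have a4 := s fun d => v (G.rot d) * u (G.rev d)
  have a5 := t fun d => v d * u (G.face d)
  have a6 := r fun d => v (G.rot d) * u d
  have b1 := r fun d => v (G.rot d) * b d
  have b2 := r fun d => v (G.rot (G.rot d)) * b (G.rot d)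
  have b3 := s fun d => v (G.rot d) * b d
  have c1 := s fun d => a (G.rot d) * u (G.face d)
  have c2 := r fun d => a d * u d
  have c3 := t fun d => a d * u d
  have c4 := t fun d => a (G.rot d) * u (G.face d)
  have e : ∀ d, a (G.rot (G.face d)) = a d := fun d => by rw [← rot_rev, ha', ha]
  simp only [rot_rev, face_rev, G.rev_rev, hu, hv, hb, hb', e, mul_neg, neg_mul,
    Finset.sum_neg_distrib] at a1 a2 a3 a4 a5 a6 b1 b2 b3 c1 c2 c3 c4
  simp only [vertexTangent, vertexNormal, faceTangent, faceNormal, add_mul, mul_add,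
    Finset.sum_add_distrib]
  linarith

theorem vertex_eq_zero {G : PlaneGraph D} (hG : G.Irreducible)
    (hF : ∀ d, (G.faceOf d).ncard = 2 ∨ (G.faceOf d).ncard = 3 ∨ (G.faceOf d).ncard = 4)
    {a v : D → ℝ} (ha : ∀ d, a (G.rev d) = a d) (ha' : ∀ d, a (G.rot (G.rot d)) = a d)
    (hv : ∀ d, v (G.rot (G.rot d)) = - v d)
    (h1 : ∀ d, G.vertexTangent a v d = 0) (h2 : ∀ d, G.vertexNormal v d = 0) :
    a = 0 ∧ v = 0 := by
  simp only [vertexTangent, vertexNormal] at h1 h2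
  have h3 : ∀ d, v (G.rot (G.face d)) = - v (G.rev d) := fun d => by rw [← rot_rev, hv]
  -- This is the face field hidden in the pair `(a, v)`: `h1` and `h2` together make it odd under
  -- `face ^ 2`, and `h2` makes it constant along circuits. Once it vanishes, both summands of the
  -- normal part equal `a d`, so `2 * a d = 0`.
  have hu : ∀ d, v (G.rot d) - a d = 0 := by
    refine hG.eq_zero hF (u := fun d => v (G.rot d) - a d) (fun d => ?_) (fun d => ?_)
    · have e1 := h1 (G.face d)
      have e2 := h2 d
      have e3 := h3 (G.face d)
      have e4 : a (G.rot (G.face d)) = a d := by rw [← rot_rev, ha', ha]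
      linarith
    · have e1 : a (G.straight d) = a d := by rw [straight_apply, ha', ha]
      have e2 := h2 d
      have e3 : v (G.rot (G.straight d)) = - v (G.face d) := by
        rw [straight_apply, hv, rot_rev]
      linarith
  have ha0 : a = 0 := by
    ext d
    have e1 := hu (G.rev d)
    have e2 := hu d
    have e3 := h2 d
    rw [rot_rev, ha] at e1
    simp only [Pi.zero_apply]
    linarith
  refine ⟨ha0, ?_⟩
  ext d
  have e1 := hu (G.rot⁻¹ d)
  simpa [ha0] using e1

theorem face_eq_zero {G : PlaneGraph D} (hG : G.Irreducible)
    (hF : ∀ d, (G.faceOf d).ncard = 2 ∨ (G.faceOf d).ncard = 3 ∨ (G.faceOf d).ncard = 4)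
    {b u : D → ℝ} (hu : ∀ d, u (G.face (G.face d)) = - u d)
    (h1 : ∀ d, G.faceTangent u d = 0) (h2 : ∀ d, G.faceNormal b u d = 0) :
    b = 0 ∧ u = 0 := by
  simp only [faceTangent, faceNormal] at h1 h2
  have h0 : u = 0 := by
    ext d
    refine hG.eq_zero hF hu (fun d => ?_) d
    have e1 := h1 (G.face d)
    rw [hu] at e1
    rw [straight_eq, face_rev]
    linarith
  refine ⟨?_, h0⟩
  ext d
  simpa [h0] using h2 d

/-- Weights on the central circuits as functions on the darts; they are invariant under reversal
and take the same value on opposite edges at a vertex. -/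
def circuitWeight (a : Set.range G.centralCircuit → ℝ) (d : D) : ℝ :=
  a ⟨G.centralCircuit d, d, rfl⟩

theorem circuitWeight_rev (hG : G.FourValent) (a : Set.range G.centralCircuit → ℝ) (d : D) :
    G.circuitWeight a (G.rev d) = G.circuitWeight a d := by
  simp only [circuitWeight, G.centralCircuit_rev hG]

theorem circuitWeight_rot_rot (hG : G.FourValent) (a : Set.range G.centralCircuit → ℝ) (d : D) :
    G.circuitWeight a (G.rot (G.rot d)) = G.circuitWeight a d := by
  simp only [circuitWeight, G.centralCircuit_rot_rot hG]

theorem circuitWeight_eq_zero {a : Set.range G.centralCircuit → ℝ} (h : G.circuitWeight a = 0) :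
    a = 0 := by
  ext ⟨_, d, rfl⟩
  exact congrFun h d

/-- On a kernel element of the combined map `T` the vertex data are minus the face data, so
orthogonality becomes a vanishing sum of squares and both kinds of data are zero. -/
theorem finrank_le_card {G : PlaneGraph D} (hG : G.Irreducible) (hV : G.FourValent)
    (hF : ∀ d, (G.faceOf d).ncard = 2 ∨ (G.faceOf d).ncard = 3 ∨ (G.faceOf d).ncard = 4) :
    2 * G.numCentralCircuits + Module.finrank ℝ (antiInvariants fun d => G.rot (G.rot d))
      + Module.finrank ℝ (antiInvariants fun d => G.face (G.face d)) ≤ Nat.card D := by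
  classical
  have : Fintype D := Fintype.ofFinite D
  have : Fintype (Set.range G.centralCircuit) := Fintype.ofFinite _
  -- Tangential and normal parts are even under `rev`. Multiplying the normal part by an odd sign
  -- packs both into one dart function, from which the values at `d` and `rev d` recover them.
  obtain ⟨ε, hε, hε'⟩ := exists_sign G.rev G.rev_rev G.rev_ne
  let V := antiInvariants fun d => G.rot (G.rot d)
  let U := antiInvariants fun d => G.face (G.face d)
  let T : (((Set.range G.centralCircuit → ℝ) × V) × ((Set.range G.centralCircuit → ℝ) × U)) →ₗ[ℝ] (D → ℝ) :=
    { toFun := fun x d => G.vertexTangent (G.circuitWeight x.1.1) x.1.2 d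
          + ε d * G.vertexNormal x.1.2 d
          + (G.faceTangent x.2.2 d + ε d * G.faceNormal (G.circuitWeight x.2.1) x.2.2 d)
      map_add' := fun x y => by
        ext d
        simp only [vertexTangent, vertexNormal, faceTangent, faceNormal, circuitWeight,
          Prod.fst_add, Prod.snd_add, Pi.add_apply, Submodule.coe_add]
        ring
      map_smul' := fun c x => by
        ext d
        simp only [vertexTangent, vertexNormal, faceTangent, faceNormal, circuitWeight,
          Prod.smul_fst, Prod.smul_snd, Pi.smul_apply, Submodule.coe_smul, smul_eq_mul,
          RingHom.id_apply]
        ring }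
  have hT : Function.Injective T := by
    rw [injective_iff_map_eq_zero]
    rintro ⟨⟨a, v, hv⟩, ⟨b, u, hu⟩⟩ h
    have h0 : ∀ d, G.vertexTangent (G.circuitWeight a) v d + ε d * G.vertexNormal v d
          + (G.faceTangent u d + ε d * G.faceNormal (G.circuitWeight b) u d) = 0 := fun d =>
      congrFun h d
    have hs := G.sum_vertex_mul_face (G.circuitWeight_rev hV a) (G.circuitWeight_rot_rot hV a)
      (G.circuitWeight_rev hV b) (G.circuitWeight_rot_rot hV b) hu hv
    have h1 := G.vertexTangent_rev (G.circuitWeight a) v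
    have h2 := G.vertexNormal_rev v
    have h3 := G.faceTangent_rev u
    have h4 := G.faceNormal_rev (G.circuitWeight b) u (G.circuitWeight_rev hV b)
    have hab : ∀ d, G.vertexTangent (G.circuitWeight a) v d = - G.faceTangent u d ∧
        G.vertexNormal v d = - G.faceNormal (G.circuitWeight b) u d := fun d => by
      have k1 := h0 d
      have k2 := h0 (G.rev d)
      rw [h1, h2, h3, h4, hε] at k2
      refine ⟨by linarith, ?_⟩
      have k3 : ε d * (G.vertexNormal v d + G.faceNormal (G.circuitWeight b) u d) = 0 := by
        linarith
      rcases mul_eq_zero.1 k3 with k | k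
      · have := hε' d
        simp [k] at this
      · linarith
    have hz : ∀ d, G.faceTangent u d = 0 ∧ G.faceNormal (G.circuitWeight b) u d = 0 := by
      have : ∑ d, (G.faceTangent u d ^ 2 + G.faceNormal (G.circuitWeight b) u d ^ 2) = 0 := by
        rw [← neg_eq_zero, ← Finset.sum_neg_distrib, ← hs]
        refine Finset.sum_congr rfl fun d _ => ?_
        rw [(hab d).1, (hab d).2]
        ring
      rw [Finset.sum_eq_zero_iff_of_nonneg fun d _ => by positivity] at this
      intro d
      have := this d (Finset.mem_univ d)
      constructor <;> nlinarith [sq_nonneg (G.faceTangent u d),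
        sq_nonneg (G.faceNormal (G.circuitWeight b) u d)]
    obtain ⟨hb0, hu0⟩ := face_eq_zero hG hF hu (fun d => (hz d).1) (fun d => (hz d).2)
    obtain ⟨ha0, hv0⟩ := vertex_eq_zero hG hF (G.circuitWeight_rev hV a)
      (G.circuitWeight_rot_rot hV a) hv (fun d => by rw [(hab d).1, (hz d).1, neg_zero])
      (fun d => by rw [(hab d).2, (hz d).2, neg_zero])
    subst hu0 hv0
    rw [G.circuitWeight_eq_zero ha0, G.circuitWeight_eq_zero hb0]
    rfl
  have := LinearMap.finrank_le_finrank_of_injective hT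
  have hK : Module.finrank ℝ (Set.range G.centralCircuit → ℝ) = G.numCentralCircuits := by
    rw [Module.finrank_fintype_fun_eq_card, numCentralCircuits, ← Nat.card_eq_fintype_card,
      Nat.card_coe_set_eq]
  rw [Module.finrank_prod, Module.finrank_prod, Module.finrank_prod, hK,
    Module.finrank_fintype_fun_eq_card, ← Nat.card_eq_fintype_card] at this
  change 2 * G.numCentralCircuits + Module.finrank ℝ V + Module.finrank ℝ U ≤ _
  omega

/-- Four times the number of central circuits is at most the total length of the faces that are
no `4`-gons. -/
theorem four_mul_numCentralCircuits_le [Fintype D] {G : PlaneGraph D} (hG : G.Irreducible)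
    (hV : G.FourValent)
    (hF : ∀ d, (G.faceOf d).ncard = 2 ∨ (G.faceOf d).ncard = 3 ∨ (G.faceOf d).ncard = 4) :
    4 * G.numCentralCircuits ≤ ({d | (G.faceOf d).ncard ≠ 4} : Finset D).card := by
  classical
  have h1 := finrank_le_card hG hV hF
  have h2 := card_le_two_mul_finrank_antiInvariants (fun d => G.rot (G.rot d)) Finset.univ
    (fun d _ => ⟨Finset.mem_univ _, hV.rot_four d, hV.rot_two_ne d⟩) (fun d _ => Finset.mem_univ d)
  have h3 := card_le_two_mul_finrank_antiInvariants (fun d => G.face (G.face d))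
    {d | (G.faceOf d).ncard = 4} (fun d hd => by
      simp only [Finset.mem_filter, Finset.mem_univ, true_and] at hd ⊢
      refine ⟨by rw [faceOf_face, faceOf_face, hd], ?_, fun k => ?_⟩
      · have := (G.face_pow_eq_iff d 4).2 (by rw [hd])
        simpa only [pow_succ, pow_zero, one_mul, Equiv.Perm.mul_apply] using this
      · have := (G.face_pow_eq_iff d 2).1 (by
          simpa only [pow_succ, pow_zero, one_mul, Equiv.Perm.mul_apply] using k)
        rw [hd] at this
        norm_num at this)
    (fun d hd => by simpa [faceOf_face] using hd)
  have h4 := Finset.card_filter_add_card_filter_not (s := (Finset.univ : Finset D))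
    fun d => (G.faceOf d).ncard = 4
  rw [Nat.card_eq_fintype_card] at h1
  rw [Finset.card_univ] at h2 h4
  simp only [ne_eq] at h4 ⊢
  omega

theorem numCentralCircuits_add_two_le {G : PlaneGraph D} {i : ℕ} (hH : G.IsHedrite i)
    (hG : G.Irreducible) : G.numCentralCircuits + 2 ≤ i := by
  classical
  have : Fintype D := Fintype.ofFinite D
  have hF : ∀ d, (G.faceOf d).ncard = 2 ∨ (G.faceOf d).ncard = 3 ∨ (G.faceOf d).ncard = 4 :=
    fun d => hH.face_size _ ⟨d, rfl⟩
  have h1 := four_mul_numCentralCircuits_le hG hH.fourValent hF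
  have hsize : ∀ F ∈ (Set.finite_range G.faceOf).toFinset,
      F.ncard = 2 ∨ F.ncard = 3 ∨ F.ncard = 4 := fun F hF =>
    hH.face_size F ((Set.finite_range G.faceOf).mem_toFinset.1 hF)
  have hne : ({d | (G.faceOf d).ncard ≠ 4} : Finset D).card
      = ∑ F ∈ (Set.finite_range G.faceOf).toFinset, if F.ncard ≠ 4 then F.ncard else 0 :=
    card_eq_sum_ncard_sameCycle G.face (· ≠ 4)
  have hall : Fintype.card D = ∑ F ∈ (Set.finite_range G.faceOf).toFinset, F.ncard := by
    have := card_eq_sum_ncard_sameCycle G.face (fun _ => True)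
    simp only [Finset.filter_true, if_true, Finset.card_univ] at this
    exact this
  have hver : Fintype.card D = (Set.range G.vertexOf).ncard * 4 := by
    have := card_eq_sum_ncard_sameCycle G.rot (fun _ => True)
    simp only [Finset.filter_true, if_true, Finset.card_univ] at this
    rw [this, Set.ncard_eq_toFinset_card _ (Set.finite_range G.vertexOf)]
    refine Finset.sum_const_nat fun F hF => ?_
    obtain ⟨d, rfl⟩ := (Set.finite_range _).mem_toFinset.1 hF
    exact hH.fourValent d
  have hedge : Fintype.card D = (Set.range fun d => {e | G.rev.SameCycle d e}).ncard * 2 := by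
    have := card_eq_sum_ncard_sameCycle G.rev (fun _ => True)
    simp only [Finset.filter_true, if_true, Finset.card_univ] at this
    rw [this, Set.ncard_eq_toFinset_card _ (Set.finite_range _)]
    refine Finset.sum_const_nat fun F hF => ?_
    obtain ⟨d, rfl⟩ := (Set.finite_range _).mem_toFinset.1 hF
    simp only
    rw [ncard_sameCycle]
    exact Function.minimalPeriod_eq_prime (G.rev_rev d) (G.rev_ne d)
  have heul : (Set.range G.vertexOf).ncard + (Set.range G.faceOf).ncard
      = (Set.range fun d => {e | G.rev.SameCycle d e}).ncard + 2 := G.euler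
  rw [Set.ncard_eq_toFinset_card _ (Set.finite_range G.faceOf)] at heul
  have hp : G.p 2 = ∑ F ∈ (Set.finite_range G.faceOf).toFinset, if F.ncard = 2 then 1 else 0 := by
    rw [p, ← Finset.card_filter, ← Set.ncard_coe_finset]
    congr 1
    ext F
    simp [faces]
  -- Each face contributes 12, whatever its length: 2 + 6 + 4, 3 + 9 or 12. With Euler's formula the
  -- first sum, the total length of the faces that are no 4-gons, becomes 24 − 4p₂ = 4i − 8.
  have hsum : (∑ F ∈ (Set.finite_range G.faceOf).toFinset, if F.ncard ≠ 4 then F.ncard else 0)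
      + 3 * (∑ F ∈ (Set.finite_range G.faceOf).toFinset, F.ncard)
      + 4 * (∑ F ∈ (Set.finite_range G.faceOf).toFinset, if F.ncard = 2 then 1 else 0)
      = 12 * (Set.finite_range G.faceOf).toFinset.card := by
    rw [Finset.mul_sum, Finset.mul_sum, ← Finset.sum_add_distrib, ← Finset.sum_add_distrib,
      mul_comm 12]
    refine Finset.sum_const_nat fun F hF => ?_
    rcases hsize F hF with h | h | h <;> simp [h]
  have := hH.p_two
  omega

end

/-! ### A criterion for 2-connectedness -/

section TwoConnected

variable {D : Type*} [Finite D] (G : PlaneGraph D)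

theorem rot_mem_vertexOf_iff (c d : D) : G.rot d ∈ G.vertexOf c ↔ d ∈ G.vertexOf c :=
  Equiv.Perm.sameCycle_apply_right

/-- A plane graph without loops none of whose faces visits a vertex twice is `2`-connected. -/
theorem twoConnected_of_faces (hloop : ∀ d, G.rev d ∉ G.vertexOf d)
    (hface : ∀ d, ∀ e ∈ G.faceOf d, e ∈ G.vertexOf d → e = d) : G.TwoConnected := by
  classical
  intro c
  set X := G.vertexOf c with hX
  have hrot : ∀ d, G.rot d ∈ X ↔ d ∈ X := G.rot_mem_vertexOf_iff c
  have hver : ∀ d ∈ X, ∀ e ∈ X, e ∈ G.vertexOf d := fun d hd e he =>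
    Equiv.Perm.SameCycle.trans (Equiv.Perm.SameCycle.symm hd) he
  have hrev : ∀ d ∈ X, G.rev d ∉ X := fun d hd h => hloop d (hver d hd _ h)
  let R : D → D → Prop := Relation.ReflTransGen
    (fun x y => y ∉ X ∧ (y ∈ G.vertexOf x ∨ y = G.rev x))
  let C : D → D → Prop := fun x y => R x y ∧ R y x
  have crefl : ∀ x, C x x := fun x => ⟨.refl, .refl⟩
  have csymm : ∀ {x y}, C x y → C y x := fun h => ⟨h.2, h.1⟩
  have ctrans : ∀ {x y z}, C x y → C y z → C x z :=
    fun h k => ⟨h.1.trans k.1, k.2.trans h.2⟩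
  have stepRot : ∀ x, x ∉ X → C x (G.rot x) := fun x hx =>
    ⟨.single ⟨mt (hrot x).1 hx, .inl ⟨1, by simp⟩⟩, .single ⟨hx, .inl ⟨-1, by simp⟩⟩⟩
  have stepRev : ∀ x, x ∉ X → G.rev x ∉ X → C x (G.rev x) := fun x hx hx' =>
    ⟨.single ⟨hx', .inr rfl⟩, .single ⟨hx, .inr (G.rev_rev x).symm⟩⟩
  -- walking along the face of `x` from the dart following `x`
  have walk : ∀ x ∈ X, ∀ n : ℕ, (∀ k, 0 < k → k ≤ n → (G.face ^ k) x ≠ x) →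
      C (G.rev x) ((G.face ^ n) (G.rot (G.rev x))) ∨ (G.face ^ (n + 1)) x = x := by
    intro x hx n
    have hout : ∀ k, (G.face ^ k) x ≠ x → (G.face ^ k) x ∉ X := fun k hk h =>
      hk (hface x _ ⟨k, by simp⟩ (hver x hx _ h))
    induction n with
    | zero => exact fun _ => .inl (stepRot _ (hrev x hx))
    | succ n ih =>
      intro h
      rcases ih fun k h0 hk => h k h0 (hk.trans n.le_succ) with h1 | h1
      · by_cases h2 : (G.face ^ (n + 2)) x = x
        · exact .inr h2
        · left
          have e1 : (G.face ^ n) (G.rot (G.rev x)) = (G.face ^ (n + 1)) x := by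
            rw [pow_succ, Equiv.Perm.mul_apply]; rfl
          have e2 : (G.face ^ (n + 1)) (G.rot (G.rev x)) = (G.face ^ (n + 2)) x := by
            rw [pow_succ G.face (n + 1), Equiv.Perm.mul_apply]; rfl
          have e3 : (G.face ^ (n + 2)) x = G.rot (G.rev ((G.face ^ (n + 1)) x)) := by
            rw [pow_succ' G.face (n + 1), Equiv.Perm.mul_apply]; rfl
          rw [e2]
          rw [e1] at h1
          have h3 := hout _ (h (n + 1) n.succ_pos le_rfl)
          have h4 := hout _ h2
          rw [e3, hrot] at h4
          rw [e3]
          exact ctrans h1 (ctrans (stepRev _ h3 h4) (stepRot _ h4))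
      · exact absurd h1 (h (n + 1) n.succ_pos le_rfl)
  -- Consecutive neighbours of the deleted vertex are joined along the face between them: the face
  -- walk from `x` meets that vertex again only when it closes up, and its last dart is `rev (rot⁻¹
  -- x)`.
  have around : ∀ x ∈ X, C (G.rev x) (G.rev (G.rot⁻¹ x)) := by
    intro x hx
    have hex : ∃ n, 0 < n ∧ (G.face ^ n) x = x :=
      ⟨orderOf G.face, orderOf_pos _, by rw [pow_orderOf_eq_one]; rfl⟩
    obtain ⟨hpos, hper⟩ := Nat.find_spec hex
    have hmin := fun k h0 (hk : k < Nat.find hex) h => Nat.find_min hex hk ⟨h0, h⟩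
    generalize Nat.find hex = p at hpos hper hmin
    have hx' : G.rot⁻¹ x ∈ X := by rw [← hrot]; simpa using hx
    have hy : G.face (G.rev (G.rot⁻¹ x)) = x := by simp [face_rev]
    have hlast : ∀ k, (G.face ^ (k + 1)) x = x → (G.face ^ k) x = G.rev (G.rot⁻¹ x) :=
      fun k hk => by
        apply G.face.injective
        rw [hy, ← Equiv.Perm.mul_apply, ← pow_succ', hk]
    match p, hpos with
    | 1, _ =>
      have h1 : x = G.rev (G.rot⁻¹ x) := hlast 0 hper
      exact absurd hx (h1 ▸ hrev _ hx')
    | n + 2, _ =>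
      have h1 := hlast (n + 1) hper
      rw [pow_succ, Equiv.Perm.mul_apply] at h1
      rw [← h1]
      exact (walk x hx n fun k h0 hk => hmin k h0 (by omega)).resolve_right
        (hmin (n + 1) n.succ_pos (by omega))
  -- Darts at the deleted vertex are pushed to their far ends, which lie elsewhere as there are no
  -- loops. A word in `rot` and `rev` thus becomes a path avoiding the vertex.
  let t : D → D := fun x => if x ∈ X then G.rev x else x
  have gen : ∀ g ∈ Subgroup.closure {G.rot, G.rev}, ∀ x, C (t x) (t (g x)) := by
    intro g hg
    induction hg using Subgroup.closure_induction with
    | mem g hg =>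
      intro x
      rcases hg with rfl | rfl
      · by_cases h : x ∈ X
        · have := around (G.rot x) ((hrot x).2 h)
          rw [Equiv.Perm.inv_def, Equiv.symm_apply_apply] at this
          simpa [t, h, hrot] using csymm this
        · simpa [t, h, hrot] using stepRot x h
      · by_cases h : x ∈ X
        · simpa [t, h, hrev x h] using crefl _
        · by_cases h' : G.rev x ∈ X
          · simpa [t, h, h', G.rev_rev] using crefl _
          · simpa [t, h, h'] using stepRev x h h'
    | one => exact fun x => crefl _
    | mul g g' _ _ h h' => exact fun x => ctrans (h' x) (h (g' x))
    | inv g _ h => exact fun x => csymm (by simpa using h (g⁻¹ x))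
  intro d e hd he
  obtain ⟨g, hg, rfl⟩ := G.connected d e
  have := (gen g hg d).1
  simpa only [t, if_neg hd, if_neg he] using this

end TwoConnected

/-! ### Plane graphs encoded by tables -/

theorem apply_eq_of_sameCycle {D α : Type*} {π : Equiv.Perm D} {φ : D → α}
    (h : ∀ x, φ (π x) = φ x) {x y : D} (hxy : π.SameCycle x y) : φ y = φ x := by
  obtain ⟨n, rfl⟩ := hxy
  induction n using Int.induction_on with
  | zero => rfl
  | succ n ih => rw [add_comm, zpow_add, zpow_one, Equiv.Perm.mul_apply, h, ih]
  | pred n ih =>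
    rw [← ih, ← h ((π ^ (-(n : ℤ) - 1)) x), ← Equiv.Perm.mul_apply, ← zpow_one_add]
    congr 3
    ring

theorem mul_card_cycles {D : Type*} [Fintype D] (π : Equiv.Perm D) (k : ℕ) :
    {F ∈ Set.range fun d => {e | π.SameCycle d e} | F.ncard = k}.ncard * k
      = ({d | Function.minimalPeriod π d = k} : Finset D).card := by
  classical
  have h := card_eq_sum_ncard_sameCycle π (· = k)
  simp only [ncard_sameCycle] at h
  rw [h, ← Finset.sum_filter, Finset.sum_const_nat fun F hF => (Finset.mem_filter.1 hF).2,
    ← Set.ncard_coe_finset]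
  congr 2
  ext F
  simp

theorem card_cycles_mul {D : Type*} [Fintype D] (π : Equiv.Perm D) (k : ℕ)
    (h : ∀ d, Function.minimalPeriod π d = k) :
    (Set.range fun d => {e | π.SameCycle d e}).ncard * k = Fintype.card D := by
  rw [← Finset.card_univ]
  have := mul_card_cycles π k
  rw [Finset.filter_true_of_mem fun d _ => h d] at this
  rw [← this]
  congr 2
  ext F
  simp only [Set.mem_range]
  constructor
  · rintro ⟨d, rfl⟩
    exact ⟨⟨d, rfl⟩, by rw [ncard_sameCycle, h]⟩
  · exact fun h => h.1

/-! Plane graphs given by tables: the darts at the vertex `v` are `4 * v`, …, `4 * v + 3` in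
counterclockwise order, and the table `T` lists the reverses of the darts. -/

def tableRot (d : ℕ) : ℕ := 4 * (d / 4) + (d + 1) % 4

def tableRev (T : List ℕ) (d : ℕ) : ℕ := T.getD d 0

def tableFace (T : List ℕ) (d : ℕ) : ℕ := tableRot (tableRev T d)

/-- The length of the face of `d`, provided that it is `2`, `3` or `4`. -/
def tableSize (T : List ℕ) (d : ℕ) : ℕ :=
  if tableFace T (tableFace T d) = d then 2
  else if tableFace T (tableFace T (tableFace T d)) = d then 3 else 4

/-- The table `T` describes a graph with `m` vertices, each connected to an earlier one, all of
whose faces are `2`-, `3`- or `4`-gons visiting no vertex twice. -/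
abbrev IsTable (m : ℕ) (T : List ℕ) : Prop :=
  (∀ v < m, 0 < v → tableRev T (4 * v) < 4 * v) ∧
  ∀ d < 4 * m, tableRev T d < 4 * m ∧ tableRev T (tableRev T d) = d ∧
    tableRev T d / 4 ≠ d / 4 ∧
    (tableFace T (tableFace T d) = d ∨ tableFace T (tableFace T d) / 4 ≠ d / 4 ∧
      (tableFace T (tableFace T (tableFace T d)) = d ∨
        tableFace T (tableFace T (tableFace T d)) / 4 ≠ d / 4 ∧
        tableFace T (tableFace T (tableFace T (tableFace T d))) = d))

theorem tableRot_lt {m d : ℕ} (h : d < 4 * m) : tableRot d < 4 * m := by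
  unfold tableRot; omega

theorem tableRot_div (d : ℕ) : tableRot d / 4 = d / 4 := by
  unfold tableRot; omega

theorem tableRot_two (d : ℕ) : tableRot (tableRot d) ≠ d := by
  unfold tableRot; omega

theorem tableRot_four (d : ℕ) : tableRot (tableRot (tableRot (tableRot d))) = d := by
  unfold tableRot; omega

def rotPerm (m : ℕ) : Equiv.Perm (Fin (4 * m)) where
  toFun d := ⟨tableRot d, tableRot_lt d.2⟩
  invFun d := ⟨tableRot (tableRot (tableRot d)), tableRot_lt (tableRot_lt (tableRot_lt d.2))⟩
  left_inv d := Fin.ext (tableRot_four d)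
  right_inv d := Fin.ext (tableRot_four d)

section
variable {m : ℕ} {T : List ℕ}

theorem tableFace_div_ne (hT : IsTable m T) (d : Fin (4 * m)) : tableFace T d / 4 ≠ d / 4 := by
  rw [tableFace, tableRot_div]
  exact (hT.2 d d.2).2.2.1

variable (hT : IsTable m T)

def revPerm : Equiv.Perm (Fin (4 * m)) where
  toFun d := ⟨tableRev T d, (hT.2 d d.2).1⟩
  invFun d := ⟨tableRev T d, (hT.2 d d.2).1⟩
  left_inv d := Fin.ext (hT.2 d d.2).2.1
  right_inv d := Fin.ext (hT.2 d d.2).2.1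

theorem val_rotPerm (d : Fin (4 * m)) : (rotPerm m d : ℕ) = tableRot d := rfl

theorem val_revPerm (d : Fin (4 * m)) : (revPerm hT d : ℕ) = tableRev T d := rfl

theorem val_face (d : Fin (4 * m)) : ((rotPerm m * revPerm hT) d : ℕ) = tableFace T d := rfl

theorem minimalPeriod_rotPerm (d : Fin (4 * m)) : Function.minimalPeriod (rotPerm m) d = 4 := by
  have : Fact (Nat.Prime 2) := ⟨Nat.prime_two⟩
  refine Function.minimalPeriod_eq_prime_pow (p := 2) (k := 1) (fun h => ?_) ?_
  · exact tableRot_two d (congrArg Fin.val h)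
  · exact Fin.ext (tableRot_four d)

theorem minimalPeriod_revPerm (d : Fin (4 * m)) : Function.minimalPeriod (revPerm hT) d = 2 := by
  have : Fact (Nat.Prime 2) := ⟨Nat.prime_two⟩
  refine Function.minimalPeriod_eq_prime (p := 2) (Fin.ext (hT.2 d d.2).2.1) fun h => ?_
  exact (hT.2 d d.2).2.2.1 (by rw [← val_revPerm hT, h])

theorem minimalPeriod_face (d : Fin (4 * m)) :
    Function.minimalPeriod (rotPerm m * revPerm hT) d = tableSize T d := by
  have : Fact (Nat.Prime 2) := ⟨Nat.prime_two⟩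
  have : Fact (Nat.Prime 3) := ⟨Nat.prime_three⟩
  have h1 : ¬ Function.IsFixedPt (rotPerm m * revPerm hT) d := fun h =>
    tableFace_div_ne hT d (by rw [← val_face hT, h])
  have h := (hT.2 d d.2).2.2.2
  rw [tableSize]
  split_ifs with h2 h3
  · exact Function.minimalPeriod_eq_prime (Fin.ext h2) h1
  · exact Function.minimalPeriod_eq_prime (Fin.ext h3) h1
  · refine Function.minimalPeriod_eq_prime_pow (p := 2) (k := 1)
      (fun h => h2 (congrArg Fin.val h)) ?_
    exact Fin.ext (by tauto)

theorem card_eq_count (p : ℕ → Prop) [DecidablePred p] (n : ℕ) :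
    ({d | p d} : Finset (Fin n)).card = Nat.count p n := by
  rw [Nat.count_eq_card_filter_range, Finset.card_filter, Finset.card_filter,
    Fin.sum_univ_eq_sum_range (fun d => if p d then 1 else 0)]

/-- The first dart at each vertex other than 0 leads to an earlier vertex, so these darts form a
spanning tree rooted at 0. -/
theorem connected_of_table (d e : Fin (4 * m)) :
    ∃ g ∈ Subgroup.closure {rotPerm m, revPerm hT}, g d = e := by
  have hrot : rotPerm m ∈ Subgroup.closure {rotPerm m, revPerm hT} :=
    Subgroup.subset_closure (by simp)
  have hrev : revPerm hT ∈ Subgroup.closure {rotPerm m, revPerm hT} :=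
    Subgroup.subset_closure (by simp)
  have key : ∀ n (hn : n < 4 * m), ∃ g ∈ Subgroup.closure {rotPerm m, revPerm hT},
      g ⟨0, by omega⟩ = (⟨n, hn⟩ : Fin (4 * m)) := by
    intro n
    induction n using Nat.strong_induction_on with
    | _ n ih =>
      intro hn
      rcases Nat.eq_zero_or_pos n with rfl | h0
      · exact ⟨1, one_mem _, rfl⟩
      by_cases h4 : 4 ∣ n
      · obtain ⟨v, rfl⟩ := h4
        obtain ⟨g, hg, h⟩ := ih _ (hT.1 v (by omega) (by omega)) (hT.2 _ hn).1
        refine ⟨revPerm hT * g, mul_mem hrev hg, ?_⟩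
        rw [Equiv.Perm.mul_apply, h]
        exact Fin.ext (hT.2 _ hn).2.1
      · obtain ⟨g, hg, h⟩ := ih (n - 1) (by omega) (by omega)
        refine ⟨rotPerm m * g, mul_mem hrot hg, ?_⟩
        rw [Equiv.Perm.mul_apply, h]
        refine Fin.ext ?_
        rw [val_rotPerm, tableRot]
        simp only
        omega
  obtain ⟨g, hg, h⟩ := key d d.2
  obtain ⟨g', hg', h'⟩ := key e e.2
  exact ⟨g' * g⁻¹, mul_mem hg' (inv_mem hg), by
    rw [Equiv.Perm.mul_apply, Equiv.Perm.inv_eq_iff_eq.2 h.symm, h']⟩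

/-- The numbers of `2`-gons and `3`-gons, found by counting the darts on their boundaries. -/
abbrev TableCount (m : ℕ) (T : List ℕ) (i : ℕ) : Prop :=
  i ≤ 8 ∧ Nat.count (fun d => tableSize T d = 2) (4 * m) + 2 * i = 16 ∧
    Nat.count (fun d => tableSize T d = 3) (4 * m) + 24 = 6 * i

theorem tableSize_cases (d : ℕ) : tableSize T d = 2 ∨ tableSize T d = 3 ∨ tableSize T d = 4 := by
  unfold tableSize
  split_ifs <;> simp

theorem ncard_cycles_face (k : ℕ) :
    {F ∈ Set.range fun d => {e | (rotPerm m * revPerm hT).SameCycle d e} | F.ncard = k}.ncard * k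
      = Nat.count (fun d => tableSize T d = k) (4 * m) := by
  rw [mul_card_cycles, ← card_eq_count]
  simp only [minimalPeriod_face]

/-- The dart counts force p₂ = 8 − i and p₃ = 2i − 8, so 2p₂ + p₃ = 8. As the face lengths add up to
4m, there are m + 2 faces, which is Euler's formula for m vertices and 2m edges. -/
theorem euler_of_table {i : ℕ} (hi : TableCount m T i) :
    (Set.range fun d => {e | (rotPerm m).SameCycle d e}).ncard
      + (Set.range fun d => {e | (rotPerm m * revPerm hT).SameCycle d e}).ncard
      = (Set.range fun d => {e | (revPerm hT).SameCycle d e}).ncard + 2 := by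
  have h1 := card_cycles_mul _ 4 (minimalPeriod_rotPerm (m := m))
  have h2 := card_cycles_mul _ 2 (minimalPeriod_revPerm hT)
  have p2 := ncard_cycles_face hT 2
  have p3 := ncard_cycles_face hT 3
  have p4 := ncard_cycles_face hT 4
  have hsum : (Set.range fun d => {e | (rotPerm m * revPerm hT).SameCycle d e}).ncard =
    {F ∈ Set.range fun d => {e | (rotPerm m * revPerm hT).SameCycle d e} | F.ncard = 2}.ncard +
    {F ∈ Set.range fun d => {e | (rotPerm m * revPerm hT).SameCycle d e} | F.ncard = 3}.ncard +
    {F ∈ Set.range fun d => {e | (rotPerm m * revPerm hT).SameCycle d e} | F.ncard = 4}.ncard := by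
    rw [← Set.ncard_union_eq, ← Set.ncard_union_eq]
    · congr 1
      ext F
      simp only [Set.mem_union, Set.mem_sep_iff, ← and_or_left, or_assoc]
      refine ⟨fun h => ⟨h, ?_⟩, fun h => h.1⟩
      obtain ⟨d, rfl⟩ := h
      rw [ncard_sameCycle, minimalPeriod_face]
      exact tableSize_cases _
    · rw [Set.disjoint_left]
      rintro F (⟨-, h⟩ | ⟨-, h⟩) ⟨-, h'⟩ <;> omega
    · rw [Set.disjoint_left]
      rintro F ⟨-, h⟩ ⟨-, h'⟩
      omega
  have hcount : Nat.count (fun d => tableSize T d = 2) (4 * m)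
      + Nat.count (fun d => tableSize T d = 3) (4 * m)
      + Nat.count (fun d => tableSize T d = 4) (4 * m) = 4 * m := by
    generalize 4 * m = n
    induction n with
    | zero => simp
    | succ n ih =>
      simp only [Nat.count_succ]
      rcases tableSize_cases (T := T) n with h | h | h <;> simp [h] <;> omega
  obtain ⟨hi, hi2, hi3⟩ := hi
  rw [Fintype.card_fin] at h1 h2
  omega

/-- The plane graph described by a table. -/
def ofTable {i : ℕ} (hi : TableCount m T i) : PlaneGraph (Fin (4 * m)) where
  rot := rotPerm m
  rev := revPerm hT
  rev_rev d := Fin.ext (hT.2 d d.2).2.1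
  rev_ne d h := (hT.2 d d.2).2.2.1 (by rw [← val_revPerm hT, h])
  connected := connected_of_table hT
  euler := euler_of_table hT hi

variable {i : ℕ} (hi : TableCount m T i)

theorem ncard_faceOf_ofTable (d : Fin (4 * m)) :
    ((ofTable hT hi).faceOf d).ncard = tableSize T d := by
  rw [faceOf, ncard_sameCycle]
  exact minimalPeriod_face hT d

theorem div_eq_of_mem_vertexOf {d e : Fin (4 * m)} (h : e ∈ (ofTable hT hi).vertexOf d) :
    (e : ℕ) / 4 = d / 4 :=
  apply_eq_of_sameCycle (π := rotPerm m) (φ := fun d => (d : ℕ) / 4)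
    (fun d => tableRot_div d) h

theorem twoConnected_ofTable : (ofTable hT hi).TwoConnected := by
  refine twoConnected_of_faces _ (fun d h => ?_) fun d e he hv => ?_
  · exact (hT.2 d d.2).2.2.1 (div_eq_of_mem_vertexOf hT hi h)
  · have hv' := div_eq_of_mem_vertexOf hT hi hv
    obtain ⟨k, hk⟩ := Equiv.Perm.SameCycle.exists_nat_pow_eq he
    -- Modulo the length of the face, at most three steps along it remain, and `IsTable` controls
    -- each of them.
    have hlt : k % tableSize T d < 4 := by
      have := Nat.mod_lt k (y := tableSize T d)
      rcases tableSize_cases (T := T) d with h | h | h <;> omega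
    have hk' : (((rotPerm m * revPerm hT) ^ (k % tableSize T d)) d) = e := by
      rw [← hk, ← minimalPeriod_face hT, ← Equiv.Perm.iterate_eq_pow,
        Function.iterate_mod_minimalPeriod_eq, Equiv.Perm.iterate_eq_pow]
      rfl
    generalize k % tableSize T d = n at hlt hk'
    have hf := tableFace_div_ne hT d
    have h := (hT.2 d d.2).2.2.2
    have hval := congrArg Fin.val hk'
    apply Fin.ext
    rw [← hval] at hv' ⊢
    interval_cases n
    · rfl
    · exact absurd hv' hf
    · change tableFace T (tableFace T d) / 4 = d / 4 at hv'
      exact h.resolve_right fun h => h.1 hv'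
    · change tableFace T (tableFace T (tableFace T d)) / 4 = d / 4 at hv'
      rcases h with h | ⟨-, h | h⟩
      · rw [h] at hv'
        exact absurd hv' hf
      · exact h
      · exact absurd hv' h.1

theorem isHedrite_ofTable : (ofTable hT hi).IsHedrite i where
  fourValent d := by
    rw [vertexOf, ncard_sameCycle]
    exact minimalPeriod_rotPerm d
  twoConnected := twoConnected_ofTable hT hi
  face_size := by
    rintro _ ⟨d, rfl⟩
    rw [ncard_faceOf_ofTable]
    exact tableSize_cases _
  p_two := by
    have h2 : (ofTable hT hi).p 2 * 2 = _ := ncard_cycles_face hT 2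
    have h := hi.2.1
    have h' := hi.1
    omega

/-- Some iterate of `f` at `d`, among the first `k`, satisfies `p`. -/
def hits (f : ℕ → ℕ) (p : ℕ → Bool) : ℕ → ℕ → Bool
  | 0, _ => false
  | k + 1, d => p d || hits f p k (f d)

/-- Along a rail-road the step "reverse, then go two darts on around the face" stays on 4-gons
forever, so meeting another face within `K` steps from every dart excludes one. -/
theorem irreducible_ofTable {K : ℕ}
    (h : ∀ d < 4 * m, hits (fun d => tableFace T (tableFace T (tableRev T d)))
      (fun d => tableSize T d ≠ 4) K d = true) : (ofTable hT hi).Irreducible := by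
  rintro ⟨k, r, -, -, hr⟩
  have key : ∀ K j, hits (fun d => tableFace T (tableFace T (tableRev T d)))
      (fun d => tableSize T d ≠ 4) K (r j) = false := by
    intro K
    induction K with
    | zero => exact fun _ => rfl
    | succ K ih =>
      intro j
      have h1 : tableSize T (r j) = 4 := by rw [← ncard_faceOf_ofTable hT hi, (hr j).1]
      have h2 := congrArg Fin.val (hr j).2
      have h3 := ih (j + 1)
      rw [h2] at h3
      rw [hits, h1]
      exact h3
  exact absurd (h _ (r 0).2) (by rw [key]; simp)

/-- Opposite darts at a vertex have the same parity, so `2 * (d / 4) + d % 2` names one of the two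
strands through it. Labels in `L` that agree along edges are constant on circuits, hence different
labels belong to different circuits. -/
theorem le_numCentralCircuits_ofTable {L : List ℕ} {n : ℕ}
    (hL : ∀ d < 4 * m, L.getD (2 * (tableRev T d / 4) + tableRev T d % 2) 0
      = L.getD (2 * (d / 4) + d % 2) 0)
    (hn : ∀ j < n, ∃ d < 4 * m, L.getD (2 * (d / 4) + d % 2) 0 = j) :
    n ≤ (ofTable hT hi).numCentralCircuits := by
  set G := ofTable hT hi
  let φ : Fin (4 * m) → ℕ := fun d => L.getD (2 * ((d : ℕ) / 4) + (d : ℕ) % 2) 0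
  have hrev : ∀ d, φ (G.rev d) = φ d := fun d => hL d d.2
  have hrot : ∀ d, φ (G.rot (G.rot d)) = φ d := fun d => by
    change L.getD (2 * (tableRot (tableRot d) / 4) + tableRot (tableRot d) % 2) 0 = _
    rw [tableRot_div, tableRot_div]
    congr 2
    unfold tableRot
    omega
  have hstr : ∀ d, φ (G.straight d) = φ d := fun d => by rw [straight_apply, hrot, hrev]
  have hφ : ∀ d e, G.centralCircuit d = G.centralCircuit e → φ d = φ e := fun d e h => by
    have he : e ∈ G.centralCircuit d := by rw [h]; exact .inl (.refl _ _)
    rcases he with he | he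
    · exact (apply_eq_of_sameCycle hstr he).symm
    · rw [← hrev e]; exact (apply_eq_of_sameCycle hstr he).symm
  choose! f hf hf' using hn
  have hinj : Function.Injective (fun j : Fin n =>
      (⟨G.centralCircuit ⟨f j, hf j j.2⟩, _, rfl⟩ : Set.range G.centralCircuit)) := by
    intro j j' h
    have := hφ _ _ (congrArg Subtype.val h)
    exact Fin.ext (by rw [← hf' j j.2, ← hf' j' j'.2]; exact this)
  have := Nat.card_le_card_of_injective _ hinj
  rwa [Nat.card_fin, Nat.card_coe_set_eq] at this
end

/-! ### The extremal graphs -/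

theorem exists_hedrite_of_table {m i K : ℕ} {T L : List ℕ} (hT : IsTable m T)
    (hi : TableCount m T i)
    (hK : ∀ d < 4 * m, hits (fun d => tableFace T (tableFace T (tableRev T d)))
      (fun d => tableSize T d ≠ 4) K d = true)
    (hL : (∀ d < 4 * m, L.getD (2 * (tableRev T d / 4) + tableRev T d % 2) 0
      = L.getD (2 * (d / 4) + d % 2) 0) ∧
      ∀ j < i - 2, ∃ d < 4 * m, L.getD (2 * (d / 4) + d % 2) 0 = j) :
    ∃ G : PlaneGraph (Fin (4 * m)),
      G.IsHedrite i ∧ G.Irreducible ∧ G.numCentralCircuits + 2 = i := by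
  refine ⟨ofTable hT hi, isHedrite_ofTable hT hi, irreducible_ofTable hT hi hK, ?_⟩
  have h1 := le_numCentralCircuits_ofTable hT hi hL.1 hL.2
  have h2 := numCentralCircuits_add_two_le (isHedrite_ofTable hT hi)
    (irreducible_ofTable hT hi hK)
  omega

/-- Two vertices joined by four parallel edges that bound four 2-gons. -/
theorem exists_hedrite_four :
    ∃ G : PlaneGraph (Fin (4 * 2)), G.IsHedrite 4 ∧ G.Irreducible ∧
      G.numCentralCircuits + 2 = 4 :=
  exists_hedrite_of_table (T :=
    [4, 7, 6, 5, 0, 3, 2, 1])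
    (L :=
    [0, 1, 0, 1]) (K := 1)
    (by decide +kernel) (by decide +kernel) (by decide +kernel) (by decide +kernel)

theorem exists_hedrite_five :
    ∃ G : PlaneGraph (Fin (4 * 6)), G.IsHedrite 5 ∧ G.Irreducible ∧
      G.numCentralCircuits + 2 = 5 :=
  exists_hedrite_of_table (T :=
    [4, 7, 8, 12, 0, 16, 20, 1, 2, 23, 22, 13, 3, 11, 18, 17, 5, 15, 14, 21, 6, 19, 10, 9])
    (L :=
    [0, 1, 0, 1, 0, 2, 1, 2, 1, 2, 0, 2]) (K := 2)
    (by decide +kernel) (by decide +kernel) (by decide +kernel) (by decide +kernel)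

theorem exists_hedrite_six :
    ∃ G : PlaneGraph (Fin (4 * 14)), G.IsHedrite 6 ∧ G.Irreducible ∧
      G.numCentralCircuits + 2 = 6 :=
  exists_hedrite_of_table (T :=
    [4, 7, 8, 12, 0, 16, 20, 1, 2, 23, 24, 28, 3, 31, 32, 17, 5, 15, 36, 40, 6, 43, 44, 9, 10,
    47, 48, 29, 11, 27, 33, 13, 14, 30, 51, 37, 18, 35, 52, 41, 19, 39, 45, 21, 22, 42, 55, 25,
    26, 54, 53, 34, 38, 50, 49, 46])
    (L :=
    [0, 1, 0, 1, 0, 2, 1, 3, 1, 3, 0, 2, 0, 3, 2, 3, 1, 2, 1, 2, 3, 2, 0, 3, 0, 1, 1, 0]) (K := 4)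
    (by decide +kernel) (by decide +kernel) (by decide +kernel) (by decide +kernel)

theorem exists_hedrite_seven :
    ∃ G : PlaneGraph (Fin (4 * 32)), G.IsHedrite 7 ∧ G.Irreducible ∧
      G.numCentralCircuits + 2 = 7 :=
  exists_hedrite_of_table (T :=
    [4, 7, 8, 12, 0, 16, 20, 1, 2, 23, 24, 28, 3, 31, 32, 17, 5, 15, 36, 40, 6, 43, 44, 9, 10,
    47, 48, 52, 11, 55, 56, 13, 14, 59, 60, 37, 18, 35, 64, 68, 19, 71, 72, 21, 22, 75, 76, 25,
    26, 79, 80, 84, 27, 87, 88, 29, 30, 91, 92, 33, 34, 95, 96, 65, 38, 63, 100, 104, 39, 107,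
    108, 41, 42, 111, 112, 45, 46, 115, 116, 49, 50, 119, 98, 120, 51, 123, 89, 53, 54, 86, 93,
    57, 58, 90, 122, 61, 62, 121, 82, 101, 66, 99, 118, 124, 67, 127, 109, 69, 70, 106, 113,
    73, 74, 110, 126, 77, 78, 125, 102, 81, 83, 97, 94, 85, 103, 117, 114, 105])
    (L :=
    [0, 0, 0, 0, 0, 1, 0, 2, 0, 2, 0, 1, 0, 3, 1, 2, 0, 4, 0, 4, 2, 1, 0, 3, 0, 4, 3, 2, 1, 4,
    0, 3, 0, 3, 4, 1, 2, 3, 0, 4, 0, 1, 4, 2, 3, 4, 1, 3, 0, 2, 0, 2, 3, 1, 4, 3, 2, 4, 0, 1,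
    1, 2, 2, 1]) (K := 10)
    (by decide +kernel) (by decide +kernel) (by decide +kernel) (by decide +kernel)

theorem exists_hedrite_eight :
    ∃ G : PlaneGraph (Fin (4 * 30)), G.IsHedrite 8 ∧ G.Irreducible ∧
      G.numCentralCircuits + 2 = 8 :=
  exists_hedrite_of_table (T :=
    [4, 8, 12, 16, 0, 20, 24, 28, 1, 31, 32, 36, 2, 39, 40, 44, 3, 47, 48, 21, 5, 19, 52, 25,
    6, 23, 56, 60, 7, 63, 33, 9, 10, 30, 64, 68, 11, 71, 41, 13, 14, 38, 72, 76, 15, 79, 49,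
    17, 18, 46, 80, 53, 22, 51, 84, 57, 26, 55, 88, 92, 27, 95, 65, 29, 34, 62, 96, 100, 35,
    103, 73, 37, 42, 70, 104, 108, 43, 111, 81, 45, 50, 78, 112, 85, 54, 83, 115, 89, 58, 87,
    116, 93, 59, 91, 97, 61, 66, 94, 119, 101, 67, 99, 105, 69, 74, 102, 118, 109, 75, 107,
    113, 77, 82, 110, 117, 86, 90, 114, 106, 98])
    (L :=
    [0, 1, 0, 2, 1, 3, 0, 4, 1, 5, 2, 5, 0, 5, 2, 3, 1, 2, 3, 4, 0, 3, 4, 5, 1, 4, 2, 4, 0, 4,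
    5, 3, 1, 5, 2, 4, 0, 2, 3, 5, 1, 3, 2, 3, 0, 3, 4, 3, 1, 4, 5, 4, 0, 5, 2, 5, 1, 2, 0, 1]) (K := 5)
    (by decide +kernel) (by decide +kernel) (by decide +kernel) (by decide +kernel)

end PlaneGraph

theorem mainTheorem2 :
    (∀ (D : Type*) [Finite D] (G : PlaneGraph D) (i : ℕ),
      G.IsHedrite i → G.Irreducible → (G.numCentralCircuits : ℤ) ≤ (i : ℤ) - 2) ∧
    (∀ i : ℕ, 4 ≤ i → i ≤ 8 →
      ∃ (n : ℕ) (G : PlaneGraph (Fin n)),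
        G.IsHedrite i ∧ G.Irreducible ∧ (G.numCentralCircuits : ℤ) = (i : ℤ) - 2) := by
  refine ⟨fun D _ G i hH hG => ?_, fun i h4 h8 => ?_⟩
  · have := PlaneGraph.numCentralCircuits_add_two_le hH hG
    omega
  · have key : ∃ (n : ℕ) (G : PlaneGraph (Fin n)),
        G.IsHedrite i ∧ G.Irreducible ∧ G.numCentralCircuits + 2 = i := by
      interval_cases i
      · exact ⟨_, PlaneGraph.exists_hedrite_four⟩
      · exact ⟨_, PlaneGraph.exists_hedrite_five⟩
      · exact ⟨_, PlaneGraph.exists_hedrite_six⟩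
      · exact ⟨_, PlaneGraph.exists_hedrite_seven⟩
      · exact ⟨_, PlaneGraph.exists_hedrite_eight⟩
    obtain ⟨n, G, hH, hG, h⟩ := key
    exact ⟨n, G, hH, hG, by omega⟩
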